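/- Let $m\ge 0$, $a>0$, and let $q:\mathbb R\to\mathbb R$ be locally integrable and $a$-periodic. Let $\sigma_2=\begin{pmatrix}0&-i\\ i&0\end{pmatrix}$, $\sigma_3=\begin{pmatrix}1&0\\0&-1\end{pmatrix}$, and let $H_0=-i\sigma_2\frac{d}{dx}+m\sigma_3+q$ be the self-adjoint periodic Dirac operator in $L^2(\mathbb R)^2$, with domain the set of all $u\in L^2(\mathbb R)^2$ that are locally absolutely continuous with $-i\sigma_2u'+(m\sigma_3+q)u\in L^2(\mathbb R)^2$. Let $p\ge 1$ be a real number, $V\in L^p(\mathbb R)^{2\times 2}\cap L^\infty(\mathbb R)^{2\times 2}$ (complex matrix-valued), and put $H=H_0+V$, where $V$ acts by multiplication, and $\|V\|_p=\big(\int_{\mathbb R}\|V(x)\|^p\,dx\big)^{1/p}$, where $\|V(x)\|$ is the operator norm of the matrix $V(x)$ with respect to the Euclidean norm $|\cdot|$ of $\mathbb C^2$. Let $\sigma_e(H)=\{\lambda\in\mathbb C\mid H-\lambda\text{ is not a Fredholm operator}\}$. For $\lambda\in\mathbb C$ let $\Phi(\cdot,\lambda)$ be the locally absolutely continuous matrix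 solution of $-i\sigma_2\Phi'+(m\sigma_3+q)\Phi=\lambda\Phi$, $\Phi(0,\lambda)=\mathbb I$; let $M(\lambda)=\Phi(a,\lambda)$ and $\mathfrak D(\lambda)=\operatorname{Tr}M(\lambda)$. Let $k(\lambda)$ be the quasimomentum: $\mathfrak D(\lambda)=2\cos(k(\lambda)a)$, $\operatorname{Im}k(\lambda)\ge 0$ (this determines $\operatorname{Im}k(\lambda)$). If $\mathfrak D(\lambda)\notin[-2,2]$, which holds for all $\lambda\notin\sigma_e(H)$, then $M(\lambda)$ has exactly one eigenvalue $\rho(\lambda)$ outside the unit circle, the other eigenvalue being $1/\rho(\lambda)$; let $v_+(\lambda)$, $v_-(\lambda)$ be eigenvectors for $\rho(\lambda)$, $1/\rho(\lambda)$, respectively, and $$\varphi_\pm(x,\lambda)=\rho(\lambda)^{\mp x/a}\,\Phi(x,\lambda)\,v_\pm(\lambda),\qquad \gamma_\pm(\lambda)=\frac{|\varphi_\pm(0,\lambda)|}{\sup_{x\in[0,a]}|\varphi_\pm(x,\lambda)|}.$$ For a matrix $A\in\mathbb C^{2\times 2}$ with two distinct eigenvalues and corresponding eigenvectors $w_1,w_2$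 let $\Gamma(A)=\frac{|\det(w_1,w_2)|}{|w_1|\,|w_2|}$. (None of these quantities depends on the choice of eigenvectors.) Then $\lambda\in\mathbb C\setminus\sigma_e(H)$ is not an eigenvalue of $H$ if $$\|V\|_1<\Gamma(M(\lambda))\,\gamma_+(\lambda)\,\gamma_-(\lambda)\qquad(\text{if }p=1),$$ $$\|V\|_p<\Gamma(M(\lambda))\,\gamma_+(\lambda)\,\gamma_-(\lambda)\,(\operatorname{Im}k(\lambda))^{\frac{p-1}p}\left(\frac p{2(p-1)}\right)^{\frac{p-1}p}\qquad(\text{if }p>1).$$ -/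

import Mathlib

open MeasureTheory
open scoped Matrix.Norms.L2Operator

noncomputable section

namespace PeriodicDirac

/-- The space `ℂ²` with its Euclidean norm. -/
abbrev C2 := EuclideanSpace ℂ (Fin 2)

/-- Complex `2 × 2` matrices; the norm in force is the operator norm with respect to the Euclidean
norm of `ℂ²`. -/
abbrev Mat2 := Matrix (Fin 2) (Fin 2) ℂ

/-- The Hilbert space `L²(ℝ)²` of (classes of) square-integrable functions `ℝ → ℂ²`. -/
abbrev L2C2 := Lp C2 2 (volume : Measure ℝ)

/-- The Pauli matrix `σ₂`. -/
def pauli2 : Mat2 := !![0, -Complex.I; Complex.I, 0]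

/-- The Pauli matrix `σ₃`. -/
def pauli3 : Mat2 := !![1, 0; 0, -1]

/-- The matrix `-i σ₂` in front of the derivative. -/
def leadingCoeff : Mat2 := (-Complex.I) • pauli2

/-- The matrix-valued potential `m σ₃ + q(x)` of the unperturbed equation. -/
def potential (m : ℝ) (q : ℝ → ℝ) (x : ℝ) : Mat2 :=
  (m : ℂ) • pauli3 + (q x : ℂ) • (1 : Mat2)

/-- `u` is locally absolutely continuous with (almost everywhere defined) derivative `g`. -/
def HasLocallyACDeriv {E : Type*} [NormedAddCommGroup E] [NormedSpace ℝ E] (u g : ℝ → E) : Prop :=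
  LocallyIntegrable g volume ∧ ∀ x y : ℝ, u y - u x = ∫ t in x..y, g t

section Operators

theorem HasLocallyACDeriv.add {E : Type*} [NormedAddCommGroup E] [NormedSpace ℝ E]
    {u g v h : ℝ → E} (hu : HasLocallyACDeriv u g) (hv : HasLocallyACDeriv v h) :
    HasLocallyACDeriv (u + v) (g + h) := by
  refine ⟨hu.1.add hv.1, fun x y => ?_⟩
  have h1 := hu.2 x y
  have h2 := hv.2 x y
  have : ∫ t in x..y, (g + h) t = (∫ t in x..y, g t) + ∫ t in x..y, h t :=
    intervalIntegral.integral_add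
      ((hu.1.integrableOn_isCompact isCompact_uIcc).intervalIntegrable)
      ((hv.1.integrableOn_isCompact isCompact_uIcc).intervalIntegrable)
  rw [this, ← h1, ← h2]
  simp only [Pi.add_apply]
  abel

theorem HasLocallyACDeriv.smul {u g : ℝ → C2} (c : ℂ) (hu : HasLocallyACDeriv u g) :
    HasLocallyACDeriv (c • u) (c • g) := by
  refine ⟨hu.1.smul c, fun x y => ?_⟩
  have : ∫ t in x..y, (c • g) t = c • ∫ t in x..y, g t :=
    intervalIntegral.integral_smul c g
  rw [this, ← hu.2 x y]
  simp [smul_sub]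

theorem HasLocallyACDeriv.continuous {E : Type*} [NormedAddCommGroup E] [NormedSpace ℝ E]
    {u g : ℝ → E} (hu : HasLocallyACDeriv u g) : Continuous u := by
  have h : u = fun x => u 0 + ∫ t in (0 : ℝ)..x, g t := by
    funext x
    rw [← hu.2 0 x]
    abel
  rw [h]
  exact continuous_const.add (intervalIntegral.continuous_primitive
    (fun a b => (hu.1.integrableOn_isCompact isCompact_uIcc).intervalIntegrable) 0)

/-- The graph of the unperturbed operator: `(f, h)` belongs to it if `f` has a locally absolutely
continuous representative `u` and `h = -i σ₂ u' + (m σ₃ + q) u` almost everywhere. -/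
def freeGraph (m : ℝ) (q : ℝ → ℝ) : Submodule ℂ (L2C2 × L2C2) where
  carrier := {w | ∃ u g : ℝ → C2, HasLocallyACDeriv u g ∧ (w.1 : ℝ → C2) =ᵐ[volume] u ∧
    (w.2 : ℝ → C2) =ᵐ[volume] fun x =>
      leadingCoeff.toEuclideanLin (g x) + (potential m q x).toEuclideanLin (u x)}
  add_mem' := by
    rintro ⟨f₁, h₁⟩ ⟨f₂, h₂⟩ ⟨u₁, g₁, hu₁, hf₁, hh₁⟩ ⟨u₂, g₂, hu₂, hf₂, hh₂⟩
    refine ⟨u₁ + u₂, g₁ + g₂, hu₁.add hu₂, ?_, ?_⟩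
    · filter_upwards [Lp.coeFn_add f₁ f₂, hf₁, hf₂] with x h h' h''
      simp only [Prod.mk_add_mk] at *
      rw [h, Pi.add_apply, h', h'', Pi.add_apply]
    · filter_upwards [Lp.coeFn_add h₁ h₂, hh₁, hh₂] with x h h' h''
      simp only [Prod.mk_add_mk] at *
      rw [h, Pi.add_apply, h', h'', Pi.add_apply, Pi.add_apply, map_add, map_add]
      abel
  zero_mem' := by
    refine ⟨0, 0, ⟨locallyIntegrable_zero, by simp⟩, Lp.coeFn_zero _ _ _, ?_⟩
    filter_upwards [Lp.coeFn_zero C2 2 (volume : Measure ℝ)] with x h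
    simp
  smul_mem' := by
    rintro c ⟨f, h⟩ ⟨u, g, hu, hf, hh⟩
    refine ⟨c • u, c • g, hu.smul c, ?_, ?_⟩
    · filter_upwards [Lp.coeFn_smul c f, hf] with x h h'
      simp only [Prod.smul_mk] at *
      rw [h, Pi.smul_apply, h', Pi.smul_apply]
    · filter_upwards [Lp.coeFn_smul c h, hh] with x h h'
      simp only [Prod.smul_mk] at *
      rw [h, Pi.smul_apply, h', Pi.smul_apply, Pi.smul_apply, map_smul, map_smul, smul_add]

/-- The graph is the graph of an operator. -/
theorem freeGraph_singleValued (m : ℝ) (q : ℝ → ℝ) (w : L2C2 × L2C2) (hw : w ∈ freeGraph m q)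
    (h0 : w.1 = 0) : w.2 = 0 := by
  obtain ⟨u, g, hu, hf, hh⟩ := hw
  rw [h0] at hf
  have hu0 : u = 0 := by
    have : u =ᵐ[volume] (0 : ℝ → C2) :=
      hf.symm.trans (Lp.coeFn_zero C2 2 (volume : Measure ℝ))
    exact (hu.continuous.ae_eq_iff_eq volume continuous_zero).1 this
  subst hu0
  have hg : g =ᵐ[volume] (0 : ℝ → C2) := by
    filter_upwards [LocallyIntegrable.ae_hasDerivAt_integral hu.1] with x hx
    have h1 := hx 0
    have h2 : (fun b => ∫ t in (0 : ℝ)..b, g t) = fun _ => (0 : C2) := by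
      funext b
      rw [← hu.2 0 b]
      simp
    rw [h2] at h1
    exact h1.unique (hasDerivAt_const x (0 : C2))
  apply Lp.ext
  filter_upwards [hh, hg, Lp.coeFn_zero C2 2 (volume : Measure ℝ)] with x h1 h2 h3
  rw [h1, h2, h3]
  simp

/-- The unperturbed periodic Dirac operator `H₀ = -i σ₂ d/dx + m σ₃ + q` in `L²(ℝ)²`, on the domain
of all `f ∈ L²(ℝ)²` that are locally absolutely continuous with `H₀ f ∈ L²(ℝ)²`; this is the
self-adjoint realisation. -/
def freeDirac (m : ℝ) (q : ℝ → ℝ) : L2C2 →ₗ.[ℂ] L2C2 :=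
  (freeGraph m q).toLinearPMap

/-- The defining property of the graph of `H₀`. -/
theorem freeDirac_graph (m : ℝ) (q : ℝ → ℝ) : (freeDirac m q).graph = freeGraph m q :=
  Submodule.toLinearPMap_graph_eq _ (freeGraph_singleValued m q)

theorem memLp_mul {V : ℝ → Mat2} (hV : MemLp V ⊤ volume) (f : L2C2) :
    MemLp (fun x => (V x).toEuclideanLin (f x)) 2 volume := by
  have hc : Continuous fun A : Mat2 => Matrix.toEuclideanCLM (n := Fin 2) (𝕜 := ℂ) A := by
    let L : Mat2 →ₗ[ℂ] (C2 →L[ℂ] C2) :=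
      (Matrix.toEuclideanCLM (n := Fin 2) (𝕜 := ℂ)).toAlgEquiv.toLinearMap
    exact L.continuous_of_finiteDimensional
  have hb : ∀ᵐ x ∂(volume : Measure ℝ), ‖V x‖ ≤ (eLpNormEssSup V volume).toReal := by
    filter_upwards [ae_le_eLpNormEssSup (f := V) (μ := volume)] with x hx
    have hfin : eLpNormEssSup V volume ≠ ⊤ := by
      have := hV.2
      rw [eLpNorm_exponent_top] at this
      exact this.ne
    have := ENNReal.toReal_mono hfin hx
    simpa using this
  refine MemLp.of_le_mul (c := (eLpNormEssSup V volume).toReal) (Lp.memLp f) ?_ ?_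
  · exact (ContinuousLinearMap.id ℂ (C2 →L[ℂ] C2)).aestronglyMeasurable_comp₂
      (hc.comp_aestronglyMeasurable hV.1) (Lp.aestronglyMeasurable f)
  · filter_upwards [hb] with x hx
    calc ‖(V x).toEuclideanLin (f x)‖
        = ‖Matrix.toEuclideanCLM (n := Fin 2) (𝕜 := ℂ) (V x) (f x)‖ := rfl
      _ ≤ ‖Matrix.toEuclideanCLM (n := Fin 2) (𝕜 := ℂ) (V x)‖ * ‖f x‖ :=
          ContinuousLinearMap.le_opNorm _ _
      _ = ‖V x‖ * ‖f x‖ := by rw [Matrix.l2_opNorm_toEuclideanCLM]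
      _ ≤ _ := by gcongr

/-- The operator of multiplication with an essentially bounded matrix-valued function `V`
in `L²(ℝ)²`. -/
def mulOperator (V : ℝ → Mat2) (hV : MemLp V ⊤ volume) : L2C2 →ₗ[ℂ] L2C2 where
  toFun f := (memLp_mul hV f).toLp (fun x => (V x).toEuclideanLin (f x))
  map_add' f g := by
    rw [← MemLp.toLp_add]
    apply MemLp.toLp_congr
    filter_upwards [Lp.coeFn_add f g] with x hx
    rw [hx, Pi.add_apply, Pi.add_apply, map_add]
  map_smul' c f := by
    rw [RingHom.id_apply, ← MemLp.toLp_const_smul]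
    apply MemLp.toLp_congr
    filter_upwards [Lp.coeFn_smul c f] with x hx
    rw [hx, Pi.smul_apply, Pi.smul_apply, map_smul]

/-- The perturbed operator `H = H₀ + V`, with the same domain as `H₀`. -/
def perturbedDirac (m : ℝ) (q : ℝ → ℝ) (V : ℝ → Mat2) (hV : MemLp V ⊤ volume) :
    L2C2 →ₗ.[ℂ] L2C2 :=
  mulOperator V hV +ᵥ freeDirac m q

/-- The operator `T - z` on the domain of `T`. -/
def shifted (T : L2C2 →ₗ.[ℂ] L2C2) (z : ℂ) : T.domain →ₗ[ℂ] L2C2 :=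
  T.toFun - z • T.domain.subtype

/-- The essential spectrum of a (closed, densely defined) operator `T`: the set of all `z` for which
`T - z` is not a Fredholm operator, i.e. fails to have closed range, finite nullity and finite
deficiency. -/
def essentialSpectrum (T : L2C2 →ₗ.[ℂ] L2C2) : Set ℂ :=
  {z | ¬ (IsClosed (LinearMap.range (shifted T z) : Set L2C2) ∧
    FiniteDimensional ℂ (LinearMap.ker (shifted T z)) ∧
    FiniteDimensional ℂ (L2C2 ⧸ LinearMap.range (shifted T z)))}

/-- `z` is an eigenvalue of `T`. -/
def IsEigenvalue (T : L2C2 →ₗ.[ℂ] L2C2) (z : ℂ) : Prop :=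
  ∃ f : T.domain, f ≠ 0 ∧ T f = z • (f : L2C2)

/-- The norm `‖V‖_p = (∫ ‖V(x)‖^p dx)^{1/p}`, with `‖V(x)‖` the operator norm of the matrix. -/
def potentialNorm (p : ℝ) (V : ℝ → Mat2) : ℝ := (∫ x : ℝ, ‖V x‖ ^ p) ^ (1 / p)

end Operators

section Floquet

/-- `Φ` solves `-i σ₂ Φ' + (m σ₃ + q) Φ = z Φ`, `Φ(0) = 𝕀`, in the sense of locally absolutely
continuous functions. -/
def IsCanonicalFundamentalSystem (m : ℝ) (q : ℝ → ℝ) (z : ℂ) (Φ : ℝ → Mat2) : Prop :=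
  Φ 0 = 1 ∧ ∃ Ψ : ℝ → Mat2, HasLocallyACDeriv Φ Ψ ∧
    ∀ᵐ x ∂(volume : Measure ℝ), leadingCoeff * Ψ x + potential m q x * Φ x = z • Φ x

open Classical in
/-- The canonical fundamental system `Φ(·, z)`, i.e. the solution of the initial value problem; it
exists and is unique for locally integrable `q` (default value `0` otherwise). -/
def fundamentalSystem (m : ℝ) (q : ℝ → ℝ) (z : ℂ) : ℝ → Mat2 :=
  if h : ∃ Φ, IsCanonicalFundamentalSystem m q z Φ then h.choose else 0

/-- The monodromy matrix `M(z) = Φ(a, z)`. -/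
def monodromy (m : ℝ) (q : ℝ → ℝ) (a : ℝ) (z : ℂ) : Mat2 := fundamentalSystem m q z a

/-- The discriminant `D(z) = Tr M(z)`. -/
def discriminant (m : ℝ) (q : ℝ → ℝ) (a : ℝ) (z : ℂ) : ℂ := (monodromy m q a z).trace

theorem exists_eq_two_mul_cos (w : ℂ) : ∃ ζ : ℂ, 0 ≤ ζ.im ∧ w = 2 * Complex.cos ζ := by
  obtain ⟨ζ, hζ⟩ := Complex.cos_surjective (w / 2)
  rcases le_total 0 ζ.im with h | h
  · exact ⟨ζ, h, by rw [hζ]; ring⟩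
  · exact ⟨-ζ, by simpa using h, by rw [Complex.cos_neg, hζ]; ring⟩

/-- The quasimomentum `k(z)`: `D(z) = 2 cos (k(z) a)` and `Im k(z) ≥ 0`. The real part depends
on the choice of a branch, the imaginary part does not; see `quasimomentum_im_unique`. -/
def quasimomentum (m : ℝ) (q : ℝ → ℝ) (a : ℝ) (z : ℂ) : ℂ :=
  (exists_eq_two_mul_cos (discriminant m q a z)).choose / a

theorem quasimomentum_spec (m : ℝ) (q : ℝ → ℝ) {a : ℝ} (ha : 0 < a) (z : ℂ) :
    0 ≤ (quasimomentum m q a z).im ∧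
      discriminant m q a z = 2 * Complex.cos (quasimomentum m q a z * a) := by
  have h := (exists_eq_two_mul_cos (discriminant m q a z)).choose_spec
  have ha' : (a : ℂ) ≠ 0 := by exact_mod_cast ha.ne'
  refine ⟨?_, ?_⟩
  · rw [quasimomentum, Complex.div_ofReal_im]
    exact div_nonneg h.1 ha.le
  · rw [quasimomentum, div_mul_cancel₀ _ ha']
    exact h.2

theorem quasimomentum_im_unique (m : ℝ) (q : ℝ → ℝ) {a : ℝ} (ha : 0 < a) (z κ : ℂ)
    (h0 : 0 ≤ κ.im) (h : discriminant m q a z = 2 * Complex.cos (κ * a)) :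
    κ.im = (quasimomentum m q a z).im := by
  obtain ⟨h0', h'⟩ := quasimomentum_spec m q ha z
  have hc : Complex.cos (κ * a) = Complex.cos (quasimomentum m q a z * a) :=
    mul_left_cancel₀ (two_ne_zero' ℂ) (h.symm.trans h')
  obtain ⟨j, hj | hj⟩ := Complex.cos_eq_cos_iff.1 hc
  · have := congrArg Complex.im hj
    simp at this
    rcases this with h | h
    · exact h.symm
    · exact absurd h ha.ne'
  · have := congrArg Complex.im hj
    simp at this
    have h1 := mul_nonneg h0 ha.le
    have h2 := mul_nonneg h0' ha.le
    have h3 : κ.im * a = (quasimomentum m q a z).im * a := by linarith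
    exact mul_right_cancel₀ ha.ne' h3

/-- `v` is an eigenvector of the matrix `A` for the eigenvalue `μ`. -/
def IsEigenvector (A : Mat2) (μ : ℂ) (v : C2) : Prop := v ≠ 0 ∧ A.toEuclideanLin v = μ • v

/-- The determinant `det (v, w)` of the matrix with columns `v` and `w`. -/
def det2 (v w : C2) : ℂ := v 0 * w 1 - w 0 * v 1

/-- `v` and `w` are eigenvectors of `A` for two different eigenvalues. -/
def IsEigenbasis (A : Mat2) (v w : C2) : Prop :=
  ∃ μ ν : ℂ, μ ≠ ν ∧ IsEigenvector A μ v ∧ IsEigenvector A ν w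

open Classical in
/-- `Γ(A) = |det (v₊, v₋)| / (|v₊| |v₋|)` for any eigenvectors `v₊`, `v₋` of `A` for two distinct
eigenvalues (default value `0` if `A` does not have two distinct eigenvalues). -/
def Gam (A : Mat2) : ℝ :=
  if h : ∃ v : C2 × C2, IsEigenbasis A v.1 v.2 then
    ‖det2 h.choose.1 h.choose.2‖ / (‖h.choose.1‖ * ‖h.choose.2‖)
  else 0

theorem IsEigenbasis.eq_smul {A : Mat2} {v w : C2} (h : IsEigenbasis A v w) {κ : ℂ} {u : C2}
    (hu : IsEigenvector A κ u) : (∃ c : ℂ, c ≠ 0 ∧ u = c • v) ∨ ∃ c : ℂ, c ≠ 0 ∧ u = c • w := by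
  obtain ⟨μ, ν, hne, hv, hw⟩ := h
  have hli : LinearIndependent ℂ ![v, w] := by
    refine LinearIndependent.pair_iff.2 fun s t hst => ?_
    have h2 := congrArg A.toEuclideanLin hst
    rw [map_add, map_smul, map_smul, hv.2, hw.2, map_zero] at h2
    have h3 : (s * (μ - ν)) • v = 0 := by
      have : (s * (μ - ν)) • v = (s • μ • v + t • ν • w) - ν • (s • v + t • w) := by module
      rw [this, h2, hst]; simp
    have hs : s = 0 := by
      rcases smul_eq_zero.1 h3 with h | h
      · exact (mul_eq_zero.1 h).resolve_right (sub_ne_zero.2 hne)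
      · exact absurd h hv.1
    subst hs
    refine ⟨rfl, ?_⟩
    rw [zero_smul, zero_add] at hst
    exact (smul_eq_zero.1 hst).resolve_right hw.1
  have hspan : u ∈ Submodule.span ℂ (Set.range ![v, w]) := by
    rw [hli.span_eq_top_of_card_eq_finrank (by simp)]
    trivial
  rw [Matrix.range_cons, Matrix.range_cons, Matrix.range_empty, Set.union_empty,
    Set.singleton_union, Submodule.mem_span_pair] at hspan
  obtain ⟨s, t, rfl⟩ := hspan
  have h2 := hu.2
  rw [map_add, map_smul, map_smul, hv.2, hw.2] at h2
  have h3 : (s * (μ - κ)) • v + (t * (ν - κ)) • w = 0 := by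
    have : (s * (μ - κ)) • v + (t * (ν - κ)) • w
        = (s • μ • v + t • ν • w) - κ • (s • v + t • w) := by module
    rw [this, h2, sub_self]
  obtain ⟨h4, h5⟩ := LinearIndependent.pair_iff.1 hli _ _ h3
  have hu0 := hu.1
  rcases mul_eq_zero.1 h4 with rfl | h4
  · right
    refine ⟨t, ?_, by simp⟩
    rintro rfl
    simp at hu0
  · rcases mul_eq_zero.1 h5 with rfl | h5
    · left
      refine ⟨s, ?_, by simp⟩
      rintro rfl
      simp at hu0
    · exact absurd ((sub_eq_zero.1 h4).trans (sub_eq_zero.1 h5).symm) hne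

/-- `Γ(A)` does not depend on the choice of the eigenvectors. -/
theorem Gam_eq {A : Mat2} {v w : C2} (h : IsEigenbasis A v w) :
    Gam A = ‖det2 v w‖ / (‖v‖ * ‖w‖) := by
  have hex : ∃ v : C2 × C2, IsEigenbasis A v.1 v.2 := ⟨(v, w), h⟩
  rw [Gam, dif_pos hex]
  have hs := hex.choose_spec
  generalize hex.choose.1 = v' at hs ⊢
  generalize hex.choose.2 = w' at hs ⊢
  obtain ⟨μ, ν, hne, hv, hw⟩ := hs
  obtain ⟨μ', ν', hne', hv', hw'⟩ := h
  have hb : IsEigenbasis A v w := ⟨μ', ν', hne', hv', hw'⟩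
  have hnv : ‖v‖ ≠ 0 := norm_ne_zero_iff.2 hv'.1
  have hnw : ‖w‖ ≠ 0 := norm_ne_zero_iff.2 hw'.1
  have key : ∀ (c d : ℂ) (x y : C2), det2 (c • x) (d • y) = c * d * det2 x y := by
    intro c d x y
    simp only [det2, PiLp.smul_apply, smul_eq_mul]
    ring
  have anti : ∀ x y : C2, det2 x y = - det2 y x := by
    intro x y
    simp only [det2]
    ring
  have same : ∀ (c d : ℂ) (x : C2), c ≠ 0 → d ≠ 0 → IsEigenvector A μ (c • x) →
      IsEigenvector A ν (d • x) → False := by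
    intro c d x hc hd h1 h2
    have hx : x ≠ 0 := by
      rintro rfl
      exact h1.1 (smul_zero c)
    have e1 := h1.2
    have e2 := h2.2
    rw [map_smul, smul_comm μ c x] at e1
    rw [map_smul, smul_comm ν d x] at e2
    have e3 := (smul_right_injective C2 hc e1).symm.trans (smul_right_injective C2 hd e2)
    exact hne (smul_left_injective ℂ hx e3)
  rcases hb.eq_smul hv with ⟨c, hc, rfl⟩ | ⟨c, hc, rfl⟩ <;>
  rcases hb.eq_smul hw with ⟨d, hd, rfl⟩ | ⟨d, hd, rfl⟩
  · exact (same c d v hc hd hv hw).elim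
  · have := norm_ne_zero_iff.2 hc
    have := norm_ne_zero_iff.2 hd
    rw [key, norm_smul, norm_smul, norm_mul, norm_mul]
    field_simp
  · have := norm_ne_zero_iff.2 hc
    have := norm_ne_zero_iff.2 hd
    rw [key, anti w v, norm_smul, norm_smul, norm_mul, norm_mul, norm_neg]
    field_simp
  · exact (same c d w hc hd hv hw).elim

open Classical in
/-- The Floquet multiplier `ρ(z)`: the eigenvalue of `M(z)` outside the unit circle. It exists, and
is unique, if and only if `D(z) ∉ [-2, 2]` (default value `0` otherwise). -/
def multiplier (m : ℝ) (q : ℝ → ℝ) (a : ℝ) (z : ℂ) : ℂ :=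
  if h : ∃ ρ : ℂ, 1 < ‖ρ‖ ∧ ∃ v, IsEigenvector (monodromy m q a z) ρ v then h.choose else 0

open Classical in
/-- An eigenvector of `A` for the eigenvalue `μ` (default value `0` if there is none). -/
def eigenvector (A : Mat2) (μ : ℂ) : C2 :=
  if h : ∃ v, IsEigenvector A μ v then h.choose else 0

/-- The eigenvector `v₊(z)` of `M(z)` for the eigenvalue `ρ(z)`. -/
def vPlus (m : ℝ) (q : ℝ → ℝ) (a : ℝ) (z : ℂ) : C2 :=
  eigenvector (monodromy m q a z) (multiplier m q a z)

/-- The eigenvector `v₋(z)` of `M(z)` for the eigenvalue `1 / ρ(z)`. -/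
def vMinus (m : ℝ) (q : ℝ → ℝ) (a : ℝ) (z : ℂ) : C2 :=
  eigenvector (monodromy m q a z) (1 / multiplier m q a z)

/-- The periodic function `φ₊(x, z)`: `Φ(x, z) v₊(z) = ρ(z)^(x/a) φ₊(x, z)`. -/
def phiPlus (m : ℝ) (q : ℝ → ℝ) (a : ℝ) (z : ℂ) (x : ℝ) : C2 :=
  multiplier m q a z ^ (-(x / a : ℂ)) •
    (fundamentalSystem m q z x).toEuclideanLin (vPlus m q a z)

/-- The periodic function `φ₋(x, z)`: `Φ(x, z) v₋(z) = ρ(z)^(-x/a) φ₋(x, z)`. -/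
def phiMinus (m : ℝ) (q : ℝ → ℝ) (a : ℝ) (z : ℂ) (x : ℝ) : C2 :=
  multiplier m q a z ^ (x / a : ℂ) •
    (fundamentalSystem m q z x).toEuclideanLin (vMinus m q a z)

/-- `γ₊(z) = |φ₊(0, z)| / sup_{x ∈ [0, a]} |φ₊(x, z)|`. -/
def gammaPlus (m : ℝ) (q : ℝ → ℝ) (a : ℝ) (z : ℂ) : ℝ :=
  ‖phiPlus m q a z 0‖ / sSup ((fun x => ‖phiPlus m q a z x‖) '' Set.Icc 0 a)

/-- `γ₋(z) = |φ₋(0, z)| / sup_{x ∈ [0, a]} |φ₋(x, z)|`. -/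
def gammaMinus (m : ℝ) (q : ℝ → ℝ) (a : ℝ) (z : ℂ) : ℝ :=
  ‖phiMinus m q a z 0‖ / sSup ((fun x => ‖phiMinus m q a z x‖) '' Set.Icc 0 a)

end Floquet

end PeriodicDirac

end

/-! The eigenfunction is estimated directly against Green's function of the unperturbed equation.
Suppose that `u` is an eigenfunction for `z`. Its continuous representative solves the unperturbed
equation with right-hand side `f = -V u`. Let ψ± = Φ v± be the Floquet solutions and κ = Im k =
log|ρ| / a. Since |φ±| is `a`-periodic, |ψ±(x)| ≤ S± exp(±κx) with S± = sup |φ±| over one period.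

The Wronskian det(ψ±, u) has a derivative of size at most |ψ±||f|, and it is arbitrarily small far
out on the side where ψ± decays: there `u`, being square-integrable, has norm at most 1 at
arbitrarily distant points. Integrating from that side and recovering `u` from the two Wronskians by
Cramer's rule gives, with W = det(v₊, v₋), |W| |u(x)| ≤ S₊ S₋ ∫ exp(-κ|x - t|) |f(t)| dt
(`IsSolution.norm_le_integral`).

As |f| ≤ ‖V‖ |u|, taking suprema yields |W| sup|u| ≤ S₊ S₋ N sup|u|, where N bounds ∫ exp(-κ|x - t|)
‖V(t)‖ dt. So `u = 0` once N < |W| / (S₊ S₋) (`IsSolution.eq_zero`), and this quotient is exactly Γ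
γ₊ γ₋ (`HasFloquetMultiplier.Gam_mul_gamma_eq`). The trivial bound on the kernel (p = 1) or Hölder's
inequality (p > 1) supplies N. -/

open Set Filter Topology

noncomputable section

namespace PeriodicDirac

/-! ### Calculus of locally absolutely continuous functions. -/

section AbsolutelyContinuous

variable {E F : Type*} [NormedAddCommGroup E] [NormedSpace ℝ E] [NormedAddCommGroup F]
  [NormedSpace ℝ F]

theorem HasLocallyACDeriv.intervalIntegrable {u g : ℝ → E} (hu : HasLocallyACDeriv u g)
    (a b : ℝ) : IntervalIntegrable g volume a b :=
  (hu.1.integrableOn_isCompact isCompact_uIcc).intervalIntegrable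

theorem HasLocallyACDeriv.congr_ae {u g h : ℝ → E} (hu : HasLocallyACDeriv u g)
    (hgh : g =ᵐ[volume] h) : HasLocallyACDeriv u h := by
  refine ⟨hu.1.congr hgh, fun x y => ?_⟩
  rw [hu.2 x y]
  exact intervalIntegral.integral_congr_ae (hgh.mono fun t ht _ => ht)

theorem HasLocallyACDeriv.clm_comp [CompleteSpace E] [CompleteSpace F] {u g : ℝ → E}
    (hu : HasLocallyACDeriv u g) (L : E →L[ℝ] F) :
    HasLocallyACDeriv (fun x => L (u x)) (fun x => L (g x)) := by
  refine ⟨fun x => ?_, fun x y => ?_⟩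
  · obtain ⟨s, hs, hi⟩ := hu.1 x
    exact ⟨s, hs, L.integrable_comp hi⟩
  · rw [L.intervalIntegral_comp_comm (hu.intervalIntegrable x y), ← hu.2, map_sub]

theorem HasLocallyACDeriv.comp_add_right {u g : ℝ → E} (hu : HasLocallyACDeriv u g) (a : ℝ) :
    HasLocallyACDeriv (fun x => u (x + a)) (fun x => g (x + a)) := by
  refine ⟨fun x => ?_, fun x y => ?_⟩
  · obtain ⟨s, hs, hi⟩ := hu.1 (x + a)
    refine ⟨(fun t => t + a) ⁻¹' s, (continuous_add_const a).continuousAt hs, ?_⟩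
    exact ((measurePreserving_add_right volume a).integrableOn_comp_preimage
      (Homeomorph.addRight a).measurableEmbedding).2 hi
  · rw [intervalIntegral.integral_comp_add_right (fun t => g t), hu.2]

theorem HasLocallyACDeriv.ae_hasDerivAt [CompleteSpace E] {u g : ℝ → E}
    (hu : HasLocallyACDeriv u g) : ∀ᵐ x, HasDerivAt u (g x) x := by
  filter_upwards [LocallyIntegrable.ae_hasDerivAt_integral hu.1] with x hx
  have h : u = fun b => u 0 + ∫ t in (0 : ℝ)..b, g t := by
    funext b
    rw [← hu.2 0 b]
    abel
  rw [h]
  exact (hx 0).const_add _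

/-- The increments of `u` are dominated by those of the primitive of ‖g‖, which is absolutely
continuous. -/
theorem HasLocallyACDeriv.absolutelyContinuousOnInterval {u g : ℝ → E}
    (hu : HasLocallyACDeriv u g) (a b : ℝ) : AbsolutelyContinuousOnInterval u a b := by
  have hac : AbsolutelyContinuousOnInterval (fun x => ∫ t in (a : ℝ)..x, ‖g t‖) a b :=
    (hu.intervalIntegrable a b).norm.absolutelyContinuousOnInterval_intervalIntegral (by simp)
  refine squeeze_zero (fun _ => Finset.sum_nonneg fun _ _ => dist_nonneg) (fun S => ?_) hac
  refine Finset.sum_le_sum fun i _ => ?_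
  rw [dist_comm, dist_eq_norm, hu.2, dist_comm, Real.dist_eq,
    intervalIntegral.integral_interval_sub_left (hu.intervalIntegrable a _).norm
      (hu.intervalIntegrable a _).norm]
  exact intervalIntegral.norm_integral_le_abs_integral_norm

/-- The difference of `u` and a primitive of `g` is absolutely continuous with derivative zero
almost everywhere, hence constant. This converse is what makes the product rule below available. -/
theorem hasLocallyACDeriv_of_ae_hasDerivAt [CompleteSpace E] {u g : ℝ → E}
    (hu : ∀ a b, AbsolutelyContinuousOnInterval u a b) (hg : LocallyIntegrable g)
    (h : ∀ᵐ x, HasDerivAt u (g x) x) : HasLocallyACDeriv u g := by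
  refine ⟨hg, fun x y => ?_⟩
  have hi : ∀ a b, IntervalIntegrable g volume a b := fun a b =>
    (hg.integrableOn_isCompact isCompact_uIcc).intervalIntegrable
  have hP : HasLocallyACDeriv (fun s => ∫ t in x..s, g t) g :=
    ⟨hg, fun s t => intervalIntegral.integral_interval_sub_left (hi x t) (hi x s)⟩
  obtain ⟨C, hC⟩ := ((hu x y).sub
    (hP.absolutelyContinuousOnInterval x y)).const_of_ae_hasDerivAt_zero (by
      filter_upwards [h, hP.ae_hasDerivAt] with t h1 h2 _
      simpa using h1.sub h2)
  have h1 := hC x (by simp)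
  have h2 := hC y (by simp)
  simp only [Pi.sub_apply, intervalIntegral.integral_same, sub_zero] at h1 h2
  rw [h1, ← h2]
  abel

theorem HasLocallyACDeriv.mul {u g v h : ℝ → ℂ} (hu : HasLocallyACDeriv u g)
    (hv : HasLocallyACDeriv v h) :
    HasLocallyACDeriv (fun x => u x * v x) (fun x => g x * v x + u x * h x) := by
  refine hasLocallyACDeriv_of_ae_hasDerivAt (fun a b =>
    (hu.absolutelyContinuousOnInterval a b).smul (hv.absolutelyContinuousOnInterval a b)) ?_ ?_
  · exact (hu.1.mul_continuous hv.continuous).add (hv.1.continuous_mul hu.continuous)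
  · filter_upwards [hu.ae_hasDerivAt, hv.ae_hasDerivAt] with x h1 h2
    exact h1.mul h2

end AbsolutelyContinuous

/-! ### Solutions of the Dirac equation, Wronskians and Floquet's theorem. -/

section Solutions

/-- `u` solves `-i σ₂ u' + (m σ₃ + q) u = z u + f` in the sense of locally absolutely continuous
functions. -/
def IsSolution (m : ℝ) (q : ℝ → ℝ) (z : ℂ) (f u : ℝ → C2) : Prop :=
  ∃ g : ℝ → C2, HasLocallyACDeriv u g ∧ ∀ᵐ x ∂(volume : Measure ℝ),
    leadingCoeff.toEuclideanLin (g x) + (potential m q x).toEuclideanLin (u x) = z • u x + f x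

variable {m : ℝ} {q : ℝ → ℝ} {z : ℂ} {f u ψ χ : ℝ → C2} {Φ : ℝ → Mat2} {a : ℝ}

theorem IsSolution.continuous (hu : IsSolution m q z f u) : Continuous u := by
  obtain ⟨g, hg, -⟩ := hu
  exact hg.continuous

theorem HasLocallyACDeriv.apply {g : ℝ → C2} (hu : HasLocallyACDeriv u g) (i : Fin 2) :
    HasLocallyACDeriv (fun x => u x i) (fun x => g x i) :=
  hu.clm_comp ((EuclideanSpace.proj i : C2 →L[ℂ] ℂ).restrictScalars ℝ)

/-- The componentwise form of the inhomogeneous Dirac equation. -/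
theorem dirac_equation_iff (x : ℝ) (v g f : C2) :
    leadingCoeff.toEuclideanLin g + (potential m q x).toEuclideanLin v = z • v + f ↔
      g 0 = (z + m - q x) * v 1 + f 1 ∧ g 1 = (m + q x - z) * v 0 - f 0 := by
  have hI : Complex.I * Complex.I = -1 := Complex.I_mul_I
  constructor
  · intro h
    have h0 := congrArg (fun w : C2 => w 0) h
    have h1 := congrArg (fun w : C2 => w 1) h
    simp [Matrix.toLpLin_apply, leadingCoeff, potential, pauli2, pauli3, dotProduct,
      Fin.sum_univ_two] at h0 h1
    constructor
    · linear_combination h1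
    · linear_combination -h0
  · rintro ⟨h0, h1⟩
    ext i
    fin_cases i
    · simp [Matrix.toLpLin_apply, leadingCoeff, potential, pauli2, pauli3, dotProduct,
        Fin.sum_univ_two]
      linear_combination -h1
    · simp [Matrix.toLpLin_apply, leadingCoeff, potential, pauli2, pauli3, dotProduct,
        Fin.sum_univ_two]
      linear_combination h0

/-- The derivative of the Wronskian of a solution of the homogeneous equation and a solution of the
inhomogeneous equation. -/
theorem IsSolution.wronskian (hψ : IsSolution m q z 0 ψ) (hu : IsSolution m q z f u) :
    HasLocallyACDeriv (fun x => det2 (ψ x) (u x))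
      (fun x => -(ψ x 0 * f x 0 + ψ x 1 * f x 1)) := by
  obtain ⟨h, hψ, hh⟩ := hψ
  obtain ⟨g, hu, hg⟩ := hu
  have hd := ((hψ.apply 0).mul (hu.apply 1)).add
    (((hu.apply 0).mul (hψ.apply 1)).clm_comp (-ContinuousLinearMap.id ℝ ℂ))
  have hw : (fun x => det2 (ψ x) (u x)) = (fun x => ψ x 0 * u x 1) +
      fun x => (-ContinuousLinearMap.id ℝ ℂ) (u x 0 * ψ x 1) := by
    funext x
    simp [det2, sub_eq_add_neg]
  rw [hw]
  refine hd.congr_ae ?_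
  -- The terms with `z`, `m` and `q` cancel because the first-order system has a trace-free
  -- coefficient matrix; only the inhomogeneity survives.
  filter_upwards [hh, hg] with x h1 h2
  obtain ⟨h3, h4⟩ := (dirac_equation_iff x _ _ _).1 h1
  obtain ⟨h5, h6⟩ := (dirac_equation_iff x _ _ _).1 h2
  simp only [Pi.add_apply, Pi.zero_apply, PiLp.zero_apply, _root_.neg_apply,
    ContinuousLinearMap.id_apply, h3, h4, h5, h6]
  ring

theorem IsSolution.wronskian_eq (hψ : IsSolution m q z 0 ψ) (hχ : IsSolution m q z 0 χ)
    (x y : ℝ) : det2 (ψ x) (χ x) = det2 (ψ y) (χ y) := by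
  have h := (hψ.wronskian hχ).2 y x
  simp only [Pi.zero_apply, PiLp.zero_apply, mul_zero, add_zero, neg_zero,
    intervalIntegral.integral_zero] at h
  exact sub_eq_zero.1 h

/-- Cramer's rule, free of division. Applied to two solutions, it plays the role of variation of
constants. -/
theorem det2_smul_eq (v w u : C2) :
    det2 v w • u = det2 v u • w - det2 w u • v := by
  ext i
  fin_cases i <;> simp [det2] <;> ring

/-- Cauchy–Schwarz: the determinant is the inner product of `w` with the conjugate of `v` turned by
a right angle. -/
theorem norm_det2_le (v w : C2) : ‖det2 v w‖ ≤ ‖v‖ * ‖w‖ := by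
  have h : det2 v w = inner ℂ (!₂[-star (v 1), star (v 0)] : C2) w := by
    simp [det2, PiLp.inner_apply, Fin.sum_univ_two]; ring
  have hn : ‖(!₂[-star (v 1), star (v 0)] : C2)‖ = ‖v‖ := by
    simp [EuclideanSpace.norm_eq, Fin.sum_univ_two, add_comm]
  rw [h, ← hn]
  exact norm_inner_le_norm _ _

theorem norm_bilin_le (v w : C2) : ‖v 0 * w 0 + v 1 * w 1‖ ≤ ‖v‖ * ‖w‖ := by
  have h : v 0 * w 0 + v 1 * w 1 = det2 v !₂[-w 1, w 0] := by simp [det2]; ring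
  have hn : ‖(!₂[-w 1, w 0] : C2)‖ = ‖w‖ := by
    simp [EuclideanSpace.norm_eq, Fin.sum_univ_two, add_comm]
  rw [h, ← hn]
  exact norm_det2_le _ _

theorem IsSolution.comp_add_right (hper : Function.Periodic q a) (hψ : IsSolution m q z 0 ψ) :
    IsSolution m q z 0 (fun x => ψ (x + a)) := by
  obtain ⟨g, hψ, hg⟩ := hψ
  refine ⟨_, hψ.comp_add_right a, ?_⟩
  filter_upwards [(measurePreserving_add_right volume a).quasiMeasurePreserving.ae hg] with x hx
  have : potential m q x = potential m q (x + a) := by rw [potential, potential, hper x]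
  rw [this]
  exact hx

theorem IsCanonicalFundamentalSystem.isSolution (hΦ : IsCanonicalFundamentalSystem m q z Φ)
    (v : C2) : IsSolution m q z 0 (fun x => (Φ x).toEuclideanLin v) := by
  obtain ⟨-, Ψ, hd, he⟩ := hΦ
  let L : Mat2 →ₗ[ℝ] C2 :=
    { toFun := fun A => A.toEuclideanLin v
      map_add' := fun A B => by simp
      map_smul' := fun c A => by
        ext i
        fin_cases i <;> simp [Matrix.toLpLin_apply] <;> ring }
  refine ⟨_, hd.clm_comp (LinearMap.toContinuousLinearMap L), ?_⟩
  filter_upwards [he] with x hx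
  have h := congrArg (fun A : Mat2 => A.toEuclideanLin v) hx
  simpa [L, Matrix.toLpLin_mul_same] using h

/-- Uniqueness without Grönwall's inequality: the Wronskians of ψ with the columns of Φ, and of the
columns with each other, are constant, so Cramer's rule expresses ψ(x) through ψ(0). -/
theorem IsCanonicalFundamentalSystem.eq_of_isSolution (hΦ : IsCanonicalFundamentalSystem m q z Φ)
    (hψ : IsSolution m q z 0 ψ) (x : ℝ) : ψ x = (Φ x).toEuclideanLin (ψ 0) := by
  have h0 := hΦ.isSolution !₂[1, 0]
  have h1 := hΦ.isSolution !₂[0, 1]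
  have e := det2_smul_eq ((Φ x).toEuclideanLin !₂[1, 0]) ((Φ x).toEuclideanLin !₂[0, 1]) (ψ x)
  rw [h0.wronskian_eq h1 x 0, h0.wronskian_eq hψ x 0, h1.wronskian_eq hψ x 0, hΦ.1] at e
  simp only [Matrix.toLpLin_one, LinearMap.id_apply] at e
  have hψ0 : ψ 0 = ψ 0 0 • !₂[1, 0] + ψ 0 1 • !₂[0, 1] := by
    ext i
    fin_cases i <;> simp
  rw [hψ0, map_add, map_smul, map_smul]
  simp [det2] at e ⊢
  rw [e]
  abel

/-- The determinant is the Wronskian of the two columns, which is constant. -/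
theorem IsCanonicalFundamentalSystem.det_eq_one (hΦ : IsCanonicalFundamentalSystem m q z Φ)
    (x : ℝ) : (Φ x).det = 1 := by
  have h := (hΦ.isSolution !₂[1, 0]).wronskian_eq (hΦ.isSolution !₂[0, 1]) x 0
  rw [hΦ.1] at h
  simpa [det2, Matrix.det_fin_two, Matrix.toLpLin_apply, Matrix.mulVec, dotProduct,
    Fin.sum_univ_two] using h

/-- Floquet's theorem for a solution starting at an eigenvector of the monodromy matrix. -/
theorem IsCanonicalFundamentalSystem.apply_add (hper : Function.Periodic q a)
    (hΦ : IsCanonicalFundamentalSystem m q z Φ) {μ : ℂ} {v : C2} (hv : IsEigenvector (Φ a) μ v)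
    (x : ℝ) : (Φ (x + a)).toEuclideanLin v = μ • (Φ x).toEuclideanLin v := by
  have h := hΦ.eq_of_isSolution ((hΦ.isSolution v).comp_add_right hper) x
  simp only [zero_add, hv.2, map_smul] at h
  exact h

end Solutions

/-! ### Exponential kernel and decay estimates. -/

section Decay

theorem integral_exp_neg_mul_abs_sub {κ : ℝ} (hκ : 0 < κ) (x : ℝ) :
    ∫ t : ℝ, Real.exp (-κ * |x - t|) = 2 / κ := by
  rw [integral_sub_left_eq_self (fun t => Real.exp (-κ * |t|)) volume x,
    integral_comp_abs (f := fun t => Real.exp (-κ * t)),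
    integral_exp_mul_Ioi (neg_lt_zero.2 hκ)]
  simp
  field_simp

theorem integrable_exp_neg_mul_abs_sub {κ : ℝ} (hκ : 0 < κ) (x : ℝ) :
    Integrable fun t : ℝ => Real.exp (-κ * |x - t|) := by
  -- A non-integrable function has Bochner integral 0, whereas this integral equals 2 / κ > 0.
  by_contra h
  have h1 := integral_undef h
  rw [integral_exp_neg_mul_abs_sub hκ] at h1
  exact (div_pos two_pos hκ).ne' h1

theorem memLp_exp_neg_mul_abs_sub {κ r : ℝ} (hκ : 0 < κ) (hr : 0 < r) (x : ℝ) :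
    MemLp (fun t : ℝ => Real.exp (-κ * |x - t|)) (ENNReal.ofReal r) := by
  have hc : Continuous fun t : ℝ => Real.exp (-κ * |x - t|) := by fun_prop
  rw [← integrable_norm_rpow_iff hc.aestronglyMeasurable (by simpa using hr) (by simp),
    ENNReal.toReal_ofReal hr.le]
  refine (integrable_exp_neg_mul_abs_sub (mul_pos hκ hr) x).congr (Eventually.of_forall fun t => ?_)
  simp only [Real.norm_eq_abs, Real.abs_exp]
  rw [← Real.exp_mul]
  ring_nf

variable {w d : ℝ → ℂ} {b : ℝ → ℝ} {x : ℝ}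

/-- Integrate `d` from a point `y` where `w` is small up to `x`. No limit of `w` at -∞ is needed,
only such points to the left of `x`. -/
theorem HasLocallyACDeriv.norm_le_setIntegral_Iic (hw : HasLocallyACDeriv w d) (hb : Integrable b)
    (hb0 : ∀ t, 0 ≤ b t) (hdb : ∀ t ≤ x, ‖d t‖ ≤ b t) (hf : ∀ ε > 0, ∃ y < x, ‖w y‖ ≤ ε) :
    ‖w x‖ ≤ ∫ t in Iic x, b t := by
  refine le_of_forall_pos_le_add fun ε hε => ?_
  obtain ⟨y, hy, hwy⟩ := hf ε hε
  have h1 : ‖w x - w y‖ ≤ ∫ t in y..x, b t := by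
    rw [hw.2 y x]
    exact intervalIntegral.norm_integral_le_of_norm_le hy.le
      (Eventually.of_forall fun t ht => hdb t ht.2) hb.intervalIntegrable
  rw [intervalIntegral.integral_of_le hy.le] at h1
  have h2 : ∫ t in Ioc y x, b t ≤ ∫ t in Iic x, b t :=
    setIntegral_mono_set hb.integrableOn (Eventually.of_forall hb0)
      (Eventually.of_forall fun t ht => ht.2)
  have h3 := norm_le_norm_add_norm_sub' (w x) (w y)
  linarith

theorem HasLocallyACDeriv.norm_le_setIntegral_Ioi (hw : HasLocallyACDeriv w d) (hb : Integrable b)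
    (hb0 : ∀ t, 0 ≤ b t) (hdb : ∀ t, x < t → ‖d t‖ ≤ b t)
    (hf : ∀ ε > 0, ∃ y, x < y ∧ ‖w y‖ ≤ ε) : ‖w x‖ ≤ ∫ t in Ioi x, b t := by
  refine le_of_forall_pos_le_add fun ε hε => ?_
  obtain ⟨y, hy, hwy⟩ := hf ε hε
  have h1 : ‖w y - w x‖ ≤ ∫ t in x..y, b t := by
    rw [hw.2 x y]
    exact intervalIntegral.norm_integral_le_of_norm_le hy.le
      (Eventually.of_forall fun t ht => hdb t ht.1) hb.intervalIntegrable
  rw [intervalIntegral.integral_of_le hy.le] at h1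
  have h2 : ∫ t in Ioc x y, b t ≤ ∫ t in Ioi x, b t :=
    setIntegral_mono_set hb.integrableOn (Eventually.of_forall hb0)
      (Eventually.of_forall fun t ht => ht.1)
  have h3 := norm_le_norm_add_norm_sub (w y) (w x)
  linarith

/-- By Chebyshev's inequality a square-integrable function reaches norm 1 only on a set of finite
measure. On a half-line this provides distant points where `u` is controlled. -/
theorem exists_mem_norm_le_one {u : ℝ → C2} (hu : MemLp u 2) {s : Set ℝ}
    (hs : volume s = ⊤) : ∃ y ∈ s, ‖u y‖ ≤ 1 := by
  by_contra! h
  have h1 := hu.meas_ge_lt_top two_ne_zero ENNReal.ofNat_ne_top one_ne_zero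
  refine (measure_mono (μ := volume) (t := {x | 1 ≤ ‖u x‖₊}) fun y hy => ?_).not_gt (hs ▸ h1)
  exact (h y hy).le

variable {m : ℝ} {q : ℝ → ℝ} {z : ℂ} {f u ψp ψm : ℝ → C2} {κ Sp Sm : ℝ}

/-- The integral estimate for a square-integrable solution of the inhomogeneous equation that
follows from the exponential decay of Green's function. -/
theorem IsSolution.norm_le_integral (hκ : 0 < κ) (hp : IsSolution m q z 0 ψp)
    (hm : IsSolution m q z 0 ψm) (hSp : ∀ x, ‖ψp x‖ ≤ Sp * Real.exp (κ * x))
    (hSm : ∀ x, ‖ψm x‖ ≤ Sm * Real.exp (-κ * x)) (hu : IsSolution m q z f u)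
    (hu2 : MemLp u 2) (hf2 : MemLp f 2) (x : ℝ) :
    ‖det2 (ψp 0) (ψm 0)‖ * ‖u x‖ ≤ Sp * Sm * ∫ t, Real.exp (-κ * |x - t|) * ‖f t‖ := by
  have hSp0 : 0 ≤ Sp := by simpa using (norm_nonneg _).trans (hSp 0)
  have hSm0 : 0 ≤ Sm := by simpa using (norm_nonneg _).trans (hSm 0)
  have he : MemLp (fun t : ℝ => Real.exp (-κ * |x - t|)) 2 := by
    simpa using memLp_exp_neg_mul_abs_sub hκ two_pos x
  set h : ℝ → ℝ := fun t => Real.exp (-κ * |x - t|) * ‖f t‖ with hdef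
  have hi : Integrable h := he.integrable_mul hf2.norm
  have h0 : ∀ t, 0 ≤ h t := fun t => by positivity
  have hwp : ‖det2 (ψp x) (u x)‖ ≤ ∫ t in Iic x, Sp * Real.exp (κ * x) * h t := by
    refine (hp.wronskian hu).norm_le_setIntegral_Iic (hi.const_mul _)
      (fun t => mul_nonneg (by positivity) (h0 t)) (fun t ht => ?_) (fun ε hε => ?_)
    · rw [norm_neg]
      refine (norm_bilin_le _ _).trans ?_
      calc ‖ψp t‖ * ‖f t‖ ≤ Sp * Real.exp (κ * t) * ‖f t‖ := by gcongr; exact hSp t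
        _ = Sp * Real.exp (κ * x) * h t := by
          simp only [hdef]
          rw [abs_of_nonneg (sub_nonneg.2 ht), show κ * t = κ * x + -κ * (x - t) by ring,
            Real.exp_add]
          ring
    -- Far to the left ψ₊ is smaller than ε, and some point there has ‖u‖ ≤ 1, so the Wronskian is
    -- at most ε at that point.
    · have hlim : Tendsto (fun y => Sp * Real.exp (κ * y)) atBot (𝓝 0) := by
        simpa using (Real.tendsto_exp_atBot.comp (tendsto_id.const_mul_atBot hκ)).const_mul Sp
      obtain ⟨N, hN⟩ := ((hlim.eventually (ge_mem_nhds hε)).and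
        (eventually_lt_atBot x)).exists_forall_of_atBot
      obtain ⟨y, hy, huy⟩ := exists_mem_norm_le_one hu2 (Real.volume_Iic (a := N))
      refine ⟨y, (hN y hy).2, (norm_det2_le _ _).trans ?_⟩
      calc ‖ψp y‖ * ‖u y‖ ≤ ‖ψp y‖ * 1 := by gcongr
        _ ≤ ε := by rw [mul_one]; exact (hSp y).trans (hN y hy).1
  have hwm : ‖det2 (ψm x) (u x)‖ ≤ ∫ t in Ioi x, Sm * Real.exp (-κ * x) * h t := by
    refine (hm.wronskian hu).norm_le_setIntegral_Ioi (hi.const_mul _)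
      (fun t => mul_nonneg (by positivity) (h0 t)) (fun t ht => ?_) (fun ε hε => ?_)
    · rw [norm_neg]
      refine (norm_bilin_le _ _).trans ?_
      calc ‖ψm t‖ * ‖f t‖ ≤ Sm * Real.exp (-κ * t) * ‖f t‖ := by gcongr; exact hSm t
        _ = Sm * Real.exp (-κ * x) * h t := by
          simp only [hdef]
          rw [abs_of_neg (sub_neg.2 ht), show -κ * t = -κ * x + -κ * -(x - t) by ring,
            Real.exp_add]
          ring
    · have hlim : Tendsto (fun y => Sm * Real.exp (-κ * y)) atTop (𝓝 0) := by
        simpa using (Real.tendsto_exp_atBot.comp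
          (tendsto_id.const_mul_atTop_of_neg (neg_lt_zero.2 hκ))).const_mul Sm
      obtain ⟨N, hN⟩ := ((hlim.eventually (ge_mem_nhds hε)).and
        (eventually_gt_atTop x)).exists_forall_of_atTop
      obtain ⟨y, hy, huy⟩ := exists_mem_norm_le_one hu2 (Real.volume_Ici (a := N))
      refine ⟨y, (hN y hy).2, (norm_det2_le _ _).trans ?_⟩
      calc ‖ψm y‖ * ‖u y‖ ≤ ‖ψm y‖ * 1 := by gcongr
        _ ≤ ε := by rw [mul_one]; exact (hSm y).trans (hN y hy).1
  rw [integral_const_mul] at hwp hwm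
  have hI0 : 0 ≤ ∫ t in Iic x, h t := integral_nonneg h0
  have hI1 : 0 ≤ ∫ t in Ioi x, h t := integral_nonneg h0
  have hsum : (∫ t in Iic x, h t) + ∫ t in Ioi x, h t = ∫ t, h t := by
    rw [← compl_Iic]
    exact integral_add_compl measurableSet_Iic hi
  have hee : Real.exp (κ * x) * Real.exp (-κ * x) = 1 := by
    rw [← Real.exp_add]; simp
  -- The Wronskian of ψ₊ and ψ₋ is moved from 0 to `x`, and Cramer's rule is applied there. The
  -- growing and decaying exponentials at `x` then cancel.
  calc ‖det2 (ψp 0) (ψm 0)‖ * ‖u x‖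
      = ‖det2 (ψp x) (u x) • ψm x - det2 (ψm x) (u x) • ψp x‖ := by
        rw [hp.wronskian_eq hm 0 x, ← norm_smul, det2_smul_eq]
    _ ≤ ‖det2 (ψp x) (u x)‖ * ‖ψm x‖ + ‖det2 (ψm x) (u x)‖ * ‖ψp x‖ := by
        rw [← norm_smul, ← norm_smul]
        exact norm_sub_le _ _
    _ ≤ (Sp * Real.exp (κ * x) * ∫ t in Iic x, h t) * (Sm * Real.exp (-κ * x)) +
          (Sm * Real.exp (-κ * x) * ∫ t in Ioi x, h t) * (Sp * Real.exp (κ * x)) := by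
        gcongr
        · exact hSm x
        · exact hSp x
    _ = Sp * Sm * ((∫ t in Iic x, h t) + ∫ t in Ioi x, h t) *
          (Real.exp (κ * x) * Real.exp (-κ * x)) := by ring
    _ = _ := by rw [hee, hsum, mul_one]

/-- A square-integrable solution of the perturbed equation vanishes if the perturbation is small
compared with Green's function. -/
theorem IsSolution.eq_zero (hκ : 0 < κ) (hp : IsSolution m q z 0 ψp)
    (hm : IsSolution m q z 0 ψm) (hSp : ∀ x, ‖ψp x‖ ≤ Sp * Real.exp (κ * x))
    (hSm : ∀ x, ‖ψm x‖ ≤ Sm * Real.exp (-κ * x)) (hu : IsSolution m q z f u)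
    (hu2 : MemLp u 2) (hf2 : MemLp f 2) {v : ℝ → ℝ} {N : ℝ}
    (hv0 : ∀ t, 0 ≤ v t) (hfv : ∀ᵐ t ∂(volume : Measure ℝ), ‖f t‖ ≤ v t * ‖u t‖)
    (hvi : ∀ x, Integrable fun t => Real.exp (-κ * |x - t|) * v t)
    (hN : ∀ x, ∫ t, Real.exp (-κ * |x - t|) * v t ≤ N)
    (hlt : Sp * Sm * N < ‖det2 (ψp 0) (ψm 0)‖) : u = 0 := by
  have hSp0 : 0 ≤ Sp := by simpa using (norm_nonneg _).trans (hSp 0)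
  have hSm0 : 0 ≤ Sm := by simpa using (norm_nonneg _).trans (hSm 0)
  have hN0 : 0 ≤ N :=
    (integral_nonneg fun t => mul_nonneg (Real.exp_nonneg _) (hv0 t)).trans (hN 0)
  have hW : 0 < ‖det2 (ψp 0) (ψm 0)‖ := lt_of_le_of_lt (by positivity) hlt
  have key := hp.norm_le_integral hκ hm hSp hSm hu hu2 hf2
  have he : ∀ x, MemLp (fun t : ℝ => Real.exp (-κ * |x - t|)) 2 := fun x => by
    simpa using memLp_exp_neg_mul_abs_sub hκ two_pos x
  have hi : ∀ x, Integrable fun t => Real.exp (-κ * |x - t|) * ‖f t‖ := fun x =>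
    (he x).integrable_mul hf2.norm
  -- Absorbing the supremum requires it to be finite. The bound, uniform in `x`, comes from e‖f‖ ≤
  -- e² + ‖f‖² with e the kernel, whose square has integral 2 / (2κ).
  have hbdd : BddAbove (range fun x => ‖u x‖) := by
    refine ⟨Sp * Sm * (2 / (2 * κ) + ∫ t, ‖f t‖ ^ 2) / ‖det2 (ψp 0) (ψm 0)‖, ?_⟩
    rintro _ ⟨x, rfl⟩
    rw [le_div_iff₀' hW]
    refine (key x).trans ?_
    gcongr
    have hi1 : Integrable fun t => ‖f t‖ ^ 2 := hf2.integrable_norm_pow two_ne_zero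
    have hi2 := integrable_exp_neg_mul_abs_sub (mul_pos two_pos hκ) x
    rw [← integral_exp_neg_mul_abs_sub (mul_pos two_pos hκ) x, ← integral_add hi2 hi1]
    refine integral_mono (hi x) (hi2.add hi1) fun t => ?_
    have h2 : Real.exp (-(2 * κ) * |x - t|) = Real.exp (-κ * |x - t|) ^ 2 := by
      rw [← Real.exp_nat_mul]
      push_cast
      ring_nf
    simp only [h2]
    nlinarith [sq_nonneg (Real.exp (-κ * |x - t|) - ‖f t‖), sq_nonneg (Real.exp (-κ * |x - t|)),
      sq_nonneg ‖f t‖]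
  set B := ⨆ x, ‖u x‖ with hB
  have hB0 : 0 ≤ B := Real.iSup_nonneg fun x => norm_nonneg _
  have hle : ∀ x, ‖u x‖ ≤ Sp * Sm * N * B / ‖det2 (ψp 0) (ψm 0)‖ := fun x => by
    rw [le_div_iff₀' hW]
    refine (key x).trans ?_
    have h1 : ∫ t, Real.exp (-κ * |x - t|) * ‖f t‖ ≤
        ∫ t, (Real.exp (-κ * |x - t|) * v t) * B := by
      refine integral_mono_ae (hi x) ((hvi x).mul_const B) ?_
      filter_upwards [hfv] with t ht
      rw [mul_assoc]
      gcongr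
      exact ht.trans (mul_le_mul_of_nonneg_left (le_ciSup hbdd t) (hv0 t))
    rw [integral_mul_const] at h1
    rw [mul_assoc (Sp * Sm)]
    gcongr
    exact h1.trans (mul_le_mul_of_nonneg_right (hN x) hB0)
  have hBle : B * ‖det2 (ψp 0) (ψm 0)‖ ≤ Sp * Sm * N * B := by
    rw [← le_div_iff₀ hW]
    exact ciSup_le hle
  -- If B > 0, dividing `hBle` by B would contradict `hlt`.
  have hBz : B = 0 := by
    by_contra hne
    have hpos : 0 < B := lt_of_le_of_ne hB0 (Ne.symm hne)
    nlinarith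
  funext x
  have := le_ciSup hbdd x
  rw [← hB, hBz] at this
  exact norm_le_zero_iff.1 this

end Decay

/-! ### Floquet multipliers, quasimomentum and bounds for Floquet solutions. -/

section FloquetTheory

variable {m : ℝ} {q : ℝ → ℝ} {z : ℂ} {a : ℝ}

theorem exists_isEigenvector_iff (A : Mat2) (μ : ℂ) :
    (∃ v, IsEigenvector A μ v) ↔ (A - μ • (1 : Mat2)).det = 0 := by
  rw [← Matrix.exists_mulVec_eq_zero_iff]
  constructor
  · rintro ⟨v, hv0, hv⟩
    refine ⟨v.ofLp, fun h => hv0 (by ext i; simp [h]), ?_⟩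
    have h := congrArg WithLp.ofLp hv
    rw [Matrix.toLpLin_apply] at h
    rw [Matrix.sub_mulVec, Matrix.smul_mulVec, Matrix.one_mulVec, sub_eq_zero]
    exact h
  · rintro ⟨v, hv0, hv⟩
    refine ⟨WithLp.toLp 2 v, fun h => hv0 (by simpa using h), ?_⟩
    rw [Matrix.sub_mulVec, Matrix.smul_mulVec, Matrix.one_mulVec, sub_eq_zero] at hv
    rw [Matrix.toLpLin_apply]
    simp [hv]

theorem isEigenvector_eigenvector {A : Mat2} {μ : ℂ} (h : ∃ v, IsEigenvector A μ v) :
    IsEigenvector A μ (eigenvector A μ) := by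
  rw [eigenvector, dif_pos h]
  exact h.choose_spec

/-- The monodromy matrix has an eigenvalue outside the unit circle. -/
def HasFloquetMultiplier (m : ℝ) (q : ℝ → ℝ) (a : ℝ) (z : ℂ) : Prop :=
  ∃ ρ : ℂ, 1 < ‖ρ‖ ∧ ∃ v, IsEigenvector (monodromy m q a z) ρ v

theorem isCanonicalFundamentalSystem_or_eq_zero (m : ℝ) (q : ℝ → ℝ) (z : ℂ) :
    IsCanonicalFundamentalSystem m q z (fundamentalSystem m q z) ∨
      fundamentalSystem m q z = 0 := by
  rw [fundamentalSystem]
  split_ifs with h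
  · exact Or.inl h.choose_spec
  · exact Or.inr rfl

/-- The default value 0 would make the monodromy matrix zero, with no eigenvalue outside the unit
circle. Existence of Φ thus follows from existence of the multiplier. -/
theorem HasFloquetMultiplier.isCanonicalFundamentalSystem (h : HasFloquetMultiplier m q a z) :
    IsCanonicalFundamentalSystem m q z (fundamentalSystem m q z) := by
  refine (isCanonicalFundamentalSystem_or_eq_zero m q z).resolve_right fun h0 => ?_
  obtain ⟨ρ, hρ, v, hv0, hv⟩ := h
  rw [monodromy, h0, Pi.zero_apply, map_zero, LinearMap.zero_apply] at hv
  rcases smul_eq_zero.1 hv.symm with rfl | h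
  · simp at hρ
    linarith
  · exact hv0 h

theorem HasFloquetMultiplier.one_lt_norm_multiplier (h : HasFloquetMultiplier m q a z) :
    1 < ‖multiplier m q a z‖ := by
  unfold HasFloquetMultiplier at h
  rw [multiplier, dif_pos h]
  exact h.choose_spec.1

theorem HasFloquetMultiplier.multiplier_ne_zero (h : HasFloquetMultiplier m q a z) :
    multiplier m q a z ≠ 0 :=
  norm_pos_iff.1 (one_pos.trans h.one_lt_norm_multiplier)

theorem HasFloquetMultiplier.isEigenvector_vPlus (h : HasFloquetMultiplier m q a z) :
    IsEigenvector (monodromy m q a z) (multiplier m q a z) (vPlus m q a z) := by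
  refine isEigenvector_eigenvector ?_
  unfold HasFloquetMultiplier at h
  rw [multiplier, dif_pos h]
  exact h.choose_spec.2

theorem HasFloquetMultiplier.discriminant_eq (h : HasFloquetMultiplier m q a z) :
    discriminant m q a z = multiplier m q a z + 1 / multiplier m q a z := by
  have hd := h.isCanonicalFundamentalSystem.det_eq_one a
  have he := (exists_isEigenvector_iff _ _).1 ⟨_, h.isEigenvector_vPlus⟩
  have h0 := h.multiplier_ne_zero
  rw [discriminant, Matrix.trace_fin_two]
  rw [← monodromy, Matrix.det_fin_two] at hd
  simp [Matrix.det_fin_two] at he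
  field_simp
  linear_combination hd - he

/-- Since det M = 1, the characteristic polynomial μ² - Dμ + 1 is reciprocal, so 1/ρ is a root along
with ρ. -/
theorem HasFloquetMultiplier.isEigenvector_vMinus (h : HasFloquetMultiplier m q a z) :
    IsEigenvector (monodromy m q a z) (1 / multiplier m q a z) (vMinus m q a z) := by
  refine isEigenvector_eigenvector ((exists_isEigenvector_iff _ _).2 ?_)
  have hd := h.isCanonicalFundamentalSystem.det_eq_one a
  have ht := h.discriminant_eq
  have h0 := h.multiplier_ne_zero
  rw [discriminant, Matrix.trace_fin_two] at ht
  rw [← monodromy, Matrix.det_fin_two] at hd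
  simp only [Matrix.det_fin_two, Matrix.sub_apply, Matrix.smul_apply, smul_eq_mul]
  simp
  field_simp at ht ⊢
  linear_combination (multiplier m q a z) ^ 2 * hd - ht

theorem HasFloquetMultiplier.isEigenbasis (h : HasFloquetMultiplier m q a z) :
    IsEigenbasis (monodromy m q a z) (vPlus m q a z) (vMinus m q a z) := by
  refine ⟨_, _, fun he => ?_, h.isEigenvector_vPlus, h.isEigenvector_vMinus⟩
  have h1 := h.one_lt_norm_multiplier
  have h2 := congrArg norm he
  rw [norm_div, norm_one] at h2
  have h3 : 1 / ‖multiplier m q a z‖ < 1 := (div_lt_one (by linarith)).2 h1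
  linarith

theorem HasFloquetMultiplier.quasimomentum_im (h : HasFloquetMultiplier m q a z) (ha : 0 < a) :
    (quasimomentum m q a z).im = Real.log ‖multiplier m q a z‖ / a := by
  have h0 := h.multiplier_ne_zero
  have ha' : (a : ℂ) ≠ 0 := by exact_mod_cast ha.ne'
  -- The candidate i log ρ / a is an admissible quasimomentum because 2 cos(i log ρ) = ρ + 1/ρ.
  -- Uniqueness of the imaginary part does the rest.
  have him : (Complex.I * Complex.log (multiplier m q a z) / a).im =
      Real.log ‖multiplier m q a z‖ / a := by
    rw [Complex.div_ofReal_im]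
    simp [Complex.log_re]
  rw [← him]
  refine (quasimomentum_im_unique m q ha z _ ?_ ?_).symm
  · rw [him]
    exact div_nonneg (Real.log_nonneg h.one_lt_norm_multiplier.le) ha.le
  · rw [div_mul_cancel₀ _ ha', h.discriminant_eq, Complex.two_cos]
    have e1 : Complex.I * Complex.log (multiplier m q a z) * Complex.I =
        -Complex.log (multiplier m q a z) := by
      linear_combination Complex.log (multiplier m q a z) * Complex.I_mul_I
    rw [neg_mul, e1, neg_neg, Complex.exp_neg, Complex.exp_log h0]
    ring

theorem HasFloquetMultiplier.quasimomentum_im_pos (h : HasFloquetMultiplier m q a z)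
    (ha : 0 < a) : 0 < (quasimomentum m q a z).im := by
  rw [h.quasimomentum_im ha]
  exact div_pos (Real.log_pos h.one_lt_norm_multiplier) ha

/-- If no Floquet multiplier lies outside the unit circle, `γ₊` takes its default value `0`, so that
the smallness condition on the perturbation cannot be satisfied. -/
theorem gammaPlus_eq_zero (h : ¬ HasFloquetMultiplier m q a z) : gammaPlus m q a z = 0 := by
  have h0 : phiPlus m q a z 0 = 0 := by
    rw [phiPlus]
    rcases isCanonicalFundamentalSystem_or_eq_zero m q z with hΦ | hΦ
    · have hv : vPlus m q a z = 0 := by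
        -- Here the multiplier has its default value 0, which is no eigenvalue as det M = 1; hence
        -- `vPlus` takes its default value 0 too.
        have hμ : multiplier m q a z = 0 := dif_neg h
        rw [vPlus, hμ, eigenvector, dif_neg]
        rw [exists_isEigenvector_iff, zero_smul, sub_zero, monodromy, hΦ.det_eq_one]
        exact one_ne_zero
      rw [hv, map_zero, smul_zero]
    · simp [hΦ]
  rw [gammaPlus, h0, norm_zero, zero_div]

/-- A Floquet solution is bounded by an exponential times the maximum of its periodic part. -/
theorem norm_le_sSup_mul_rpow (ha : 0 < a) {ψ φ : ℝ → C2} {r : ℝ} (hr : 0 < r)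
    (hc : Continuous ψ) (hψ : ∀ x, ‖ψ (x + a)‖ = r * ‖ψ x‖)
    (hφ : ∀ x, ‖φ x‖ = r ^ (-(x / a)) * ‖ψ x‖) (x : ℝ) :
    ‖ψ x‖ ≤ sSup ((fun x => ‖φ x‖) '' Icc 0 a) * r ^ (x / a) := by
  have hcφ : Continuous fun x => ‖φ x‖ := by
    simp only [hφ]
    exact (Real.continuous_const_rpow hr.ne' |>.comp (by fun_prop)).mul hc.norm
  have hper : Function.Periodic (fun x => ‖φ x‖) a := fun x => by
    simp only [hφ, hψ, add_div, div_self ha.ne', neg_add, Real.rpow_add hr, Real.rpow_neg_one]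
    field_simp
  obtain ⟨y, hy, hxy⟩ := hper.exists_mem_Ico₀ ha x
  have hle : ‖φ x‖ ≤ sSup ((fun x => ‖φ x‖) '' Icc 0 a) := by
    rw [hxy]
    exact le_csSup (isCompact_Icc.image hcφ).bddAbove ⟨y, Ico_subset_Icc_self hy, rfl⟩
  rw [hφ, Real.rpow_neg hr.le] at hle
  have hpos : 0 < r ^ (x / a) := Real.rpow_pos_of_pos hr _
  rwa [inv_mul_le_iff₀ hpos, mul_comm] at hle

theorem rpow_div_eq_exp {r : ℝ} (hr : 0 < r) (x a : ℝ) :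
    r ^ (x / a) = Real.exp (Real.log r / a * x) := by
  rw [Real.rpow_def_of_pos hr]
  ring_nf

theorem HasFloquetMultiplier.norm_plus_le (h : HasFloquetMultiplier m q a z) (ha : 0 < a)
    (hper : Function.Periodic q a) (x : ℝ) :
    ‖(fundamentalSystem m q z x).toEuclideanLin (vPlus m q a z)‖ ≤
      sSup ((fun x => ‖phiPlus m q a z x‖) '' Icc 0 a) *
        Real.exp ((quasimomentum m q a z).im * x) := by
  have hΦ := h.isCanonicalFundamentalSystem
  have hr := norm_pos_iff.2 h.multiplier_ne_zero
  rw [h.quasimomentum_im ha, ← rpow_div_eq_exp hr]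
  refine norm_le_sSup_mul_rpow ha hr (hΦ.isSolution _).continuous (fun y => ?_) (fun y => ?_) x
  · rw [hΦ.apply_add hper h.isEigenvector_vPlus, norm_smul]
  · rw [phiPlus, norm_smul]
    congr 1
    exact_mod_cast Complex.norm_cpow_real _ (-(y / a))

theorem HasFloquetMultiplier.norm_minus_le (h : HasFloquetMultiplier m q a z) (ha : 0 < a)
    (hper : Function.Periodic q a) (x : ℝ) :
    ‖(fundamentalSystem m q z x).toEuclideanLin (vMinus m q a z)‖ ≤
      sSup ((fun x => ‖phiMinus m q a z x‖) '' Icc 0 a) *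
        Real.exp (-(quasimomentum m q a z).im * x) := by
  have hΦ := h.isCanonicalFundamentalSystem
  have hr := norm_pos_iff.2 h.multiplier_ne_zero
  -- The minus solution is the case r = 1/|ρ| of the general bound.
  have he : Real.exp (-(quasimomentum m q a z).im * x) = (‖multiplier m q a z‖⁻¹) ^ (x / a) := by
    rw [h.quasimomentum_im ha, rpow_div_eq_exp (inv_pos.2 hr), Real.log_inv, neg_div]
  rw [he]
  refine norm_le_sSup_mul_rpow ha (inv_pos.2 hr) (hΦ.isSolution _).continuous (fun y => ?_)
    (fun y => ?_) x
  · rw [hΦ.apply_add hper h.isEigenvector_vMinus, norm_smul, one_div, norm_inv]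
  · rw [phiMinus, norm_smul, Real.inv_rpow hr.le, Real.rpow_neg hr.le, inv_inv]
    congr 1
    exact_mod_cast Complex.norm_cpow_real _ (y / a)

/-- As φ±(0) = v±, the numerators of γ± cancel the norms in the denominator of Γ, leaving the
constant of the Green's function estimate. -/
theorem HasFloquetMultiplier.Gam_mul_gamma_eq (h : HasFloquetMultiplier m q a z) :
    Gam (monodromy m q a z) * gammaPlus m q a z * gammaMinus m q a z =
      ‖det2 (vPlus m q a z) (vMinus m q a z)‖ /
        (sSup ((fun x => ‖phiPlus m q a z x‖) '' Icc 0 a) *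
          sSup ((fun x => ‖phiMinus m q a z x‖) '' Icc 0 a)) := by
  have hΦ := h.isCanonicalFundamentalSystem
  have h1 : ‖vPlus m q a z‖ ≠ 0 := norm_ne_zero_iff.2 h.isEigenvector_vPlus.1
  have h2 : ‖vMinus m q a z‖ ≠ 0 := norm_ne_zero_iff.2 h.isEigenvector_vMinus.1
  rw [Gam_eq h.isEigenbasis, gammaPlus, gammaMinus]
  have e1 : phiPlus m q a z 0 = vPlus m q a z := by simp [phiPlus, hΦ.1]
  have e2 : phiMinus m q a z 0 = vMinus m q a z := by simp [phiMinus, hΦ.1]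
  rw [e1, e2]
  field_simp

end FloquetTheory

/-! ### Absence of eigenvalues and the kernel bounds in terms of ‖V‖_p. -/

section Eigenvalues

variable {m : ℝ} {q : ℝ → ℝ} {z : ℂ} {a : ℝ} {V : ℝ → Mat2}

/-- An eigenfunction has a nontrivial continuous representative that solves the inhomogeneous
unperturbed equation with right-hand side `-V u`. -/
theorem IsEigenvalue.exists_isSolution {hV : MemLp V ⊤ volume}
    (h : IsEigenvalue (perturbedDirac m q V hV) z) :
    ∃ f u : ℝ → C2, IsSolution m q z f u ∧ u ≠ 0 ∧ MemLp u 2 ∧ MemLp f 2 ∧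
      ∀ᵐ t ∂(volume : Measure ℝ), ‖f t‖ ≤ ‖V t‖ * ‖u t‖ := by
  obtain ⟨w, hw0, hw⟩ := h
  have hg : ((w : L2C2), freeDirac m q w) ∈ freeGraph m q := by
    rw [← freeDirac_graph]
    exact (freeDirac m q).mem_graph w
  obtain ⟨u, g, hu, hfu, hh⟩ := hg
  have hVw : (mulOperator V hV w : ℝ → C2) =ᵐ[volume] fun x => (V x).toEuclideanLin (w.1 x) :=
    MemLp.coeFn_toLp (memLp_mul hV w)
  have hsum : mulOperator V hV w + freeDirac m q w = z • (w : L2C2) := hw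
  refine ⟨fun x => -(mulOperator V hV w x), u, ⟨g, hu, ?_⟩, ?_, ?_, ?_, ?_⟩
  · have hsum' := Lp.ext_iff.1 hsum
    filter_upwards [hsum', hfu, hh, Lp.coeFn_add (mulOperator V hV w) (freeDirac m q w),
      Lp.coeFn_smul z (w : L2C2)] with x h1 h2 h3 h4 h5
    replace h2 : (w : L2C2) x = u x := h2
    replace h3 : freeDirac m q w x = _ := h3
    rw [h4, h5, Pi.add_apply, Pi.smul_apply, h2, h3] at h1
    rw [← h1]
    abel
  · rintro rfl
    refine hw0 (Subtype.ext (Lp.ext ?_))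
    exact hfu.trans (Lp.coeFn_zero C2 2 (volume : Measure ℝ)).symm
  · exact (memLp_congr_ae hfu).1 (Lp.memLp _)
  · exact (Lp.memLp (mulOperator V hV w)).neg
  · filter_upwards [hVw, hfu] with x h1 h2
    replace h2 : (w : L2C2) x = u x := h2
    rw [norm_neg, h1, h2]
    calc ‖(V x).toEuclideanLin (u x)‖
        = ‖Matrix.toEuclideanCLM (n := Fin 2) (𝕜 := ℂ) (V x) (u x)‖ := rfl
      _ ≤ ‖Matrix.toEuclideanCLM (n := Fin 2) (𝕜 := ℂ) (V x)‖ * ‖u x‖ :=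
          ContinuousLinearMap.le_opNorm _ _
      _ = ‖V x‖ * ‖u x‖ := by rw [Matrix.l2_opNorm_toEuclideanCLM]

/-- A criterion for the absence of an eigenvalue in terms of the Floquet data. -/
theorem HasFloquetMultiplier.not_isEigenvalue (h : HasFloquetMultiplier m q a z) (ha : 0 < a)
    (hper : Function.Periodic q a) (hV : MemLp V ⊤ volume) {N : ℝ}
    (hVi : ∀ x, Integrable fun t => Real.exp (-(quasimomentum m q a z).im * |x - t|) * ‖V t‖)
    (hN : ∀ x, ∫ t, Real.exp (-(quasimomentum m q a z).im * |x - t|) * ‖V t‖ ≤ N)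
    (hlt : N < Gam (monodromy m q a z) * gammaPlus m q a z * gammaMinus m q a z) :
    ¬ IsEigenvalue (perturbedDirac m q V hV) z := by
  intro hev
  obtain ⟨f, u, hu, hu0, hu2, hf2, hfv⟩ := hev.exists_isSolution
  have hΦ := h.isCanonicalFundamentalSystem
  have hp := h.norm_plus_le ha hper
  have hm := h.norm_minus_le ha hper
  rw [h.Gam_mul_gamma_eq] at hlt
  -- The exponential bound at x = 0 shows that the supremum is at least |v₊| > 0, so the denominator
  -- can be cleared.
  have hSp : 0 < sSup ((fun x => ‖phiPlus m q a z x‖) '' Icc 0 a) := by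
    refine (norm_pos_iff.2 h.isEigenvector_vPlus.1).trans_le ?_
    simpa [hΦ.1] using hp 0
  have hSm : 0 < sSup ((fun x => ‖phiMinus m q a z x‖) '' Icc 0 a) := by
    refine (norm_pos_iff.2 h.isEigenvector_vMinus.1).trans_le ?_
    simpa [hΦ.1] using hm 0
  rw [lt_div_iff₀' (mul_pos hSp hSm)] at hlt
  refine hu0 ((hΦ.isSolution _).eq_zero (h.quasimomentum_im_pos ha) (hΦ.isSolution _) hp hm hu hu2
    hf2 (fun t => norm_nonneg (V t)) hfv hVi hN ?_)
  simpa [hΦ.1] using hlt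

theorem potentialNorm_nonneg (p : ℝ) (V : ℝ → Mat2) : 0 ≤ potentialNorm p V :=
  Real.rpow_nonneg (integral_nonneg fun _ => Real.rpow_nonneg (norm_nonneg _) _) _

theorem integrable_exp_neg_mul_abs_sub_mul_norm {κ : ℝ} (hκ : 0 < κ) (hV : MemLp V ⊤ volume)
    (x : ℝ) : Integrable fun t => Real.exp (-κ * |x - t|) * ‖V t‖ :=
  (memLp_one_iff_integrable.2 (integrable_exp_neg_mul_abs_sub hκ x)).integrable_mul hV.norm

theorem integral_exp_neg_mul_abs_sub_mul_norm_le_one {κ : ℝ} (hκ : 0 < κ)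
    (hV : MemLp V ⊤ volume) (hV1 : Integrable V) (x : ℝ) :
    ∫ t, Real.exp (-κ * |x - t|) * ‖V t‖ ≤ potentialNorm 1 V := by
  rw [potentialNorm, div_one, Real.rpow_one]
  simp only [Real.rpow_one]
  refine integral_mono (integrable_exp_neg_mul_abs_sub_mul_norm hκ hV x) hV1.norm fun t => ?_
  refine mul_le_of_le_one_left (norm_nonneg _) (Real.exp_le_one_iff.2 ?_)
  have := mul_nonneg hκ.le (abs_nonneg (x - t))
  linarith

/-- Hölder's inequality with p' = p / (p - 1): the p'-th power of the kernel has integral 2 / (κp').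
-/
theorem integral_exp_neg_mul_abs_sub_mul_norm_le {κ p : ℝ} (hκ : 0 < κ) (hp : 1 < p)
    (hVp : MemLp V (ENNReal.ofReal p) volume) (x : ℝ) :
    ∫ t, Real.exp (-κ * |x - t|) * ‖V t‖ ≤
      (2 * (p - 1) / (κ * p)) ^ ((p - 1) / p) * potentialNorm p V := by
  have hc := Real.HolderConjugate.conjExponent hp
  have h := integral_mul_le_Lp_mul_Lq_of_nonneg (μ := volume) hc.symm
    (Eventually.of_forall fun t => Real.exp_nonneg (-κ * |x - t|))
    (Eventually.of_forall fun t => norm_nonneg (V t))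
    (memLp_exp_neg_mul_abs_sub hκ hc.symm.pos x) hVp.norm
  refine h.trans (le_of_eq ?_)
  have hp0 : 0 < p := one_pos.trans hp
  have hp1 : 0 < p - 1 := sub_pos.2 hp
  rw [potentialNorm]
  congr 1
  have e : ∀ t, Real.exp (-κ * |x - t|) ^ (p.conjExponent) =
      Real.exp (-(κ * p.conjExponent) * |x - t|) := fun t => by
    rw [← Real.exp_mul]
    ring_nf
  simp only [e]
  rw [integral_exp_neg_mul_abs_sub (mul_pos hκ hc.symm.pos), Real.conjExponent, one_div_div]
  congr 1
  field_simp

end Eigenvalues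

end PeriodicDirac

end

open PeriodicDirac in
theorem mainTheorem1
    (m : ℝ) (hm : 0 ≤ m)
    (q : ℝ → ℝ) (hq : LocallyIntegrable q volume)
    (a : ℝ) (ha : 0 < a) (hper : Function.Periodic q a)
    (p : ℝ) (hp : 1 ≤ p)
    (V : ℝ → Matrix (Fin 2) (Fin 2) ℂ)
    (hVp : MemLp V (ENNReal.ofReal p) volume) (hV : MemLp V ⊤ volume)
    (z : ℂ) (hz : z ∉ essentialSpectrum (perturbedDirac m q V hV)) :
    (p = 1 →
      potentialNorm 1 V <
        Gam (monodromy m q a z) * gammaPlus m q a z * gammaMinus m q a z →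
      ¬ IsEigenvalue (perturbedDirac m q V hV) z) ∧
    (1 < p →
      potentialNorm p V <
        Gam (monodromy m q a z) * gammaPlus m q a z * gammaMinus m q a z *
          (quasimomentum m q a z).im ^ ((p - 1) / p) * (p / (2 * (p - 1))) ^ ((p - 1) / p) →
      ¬ IsEigenvalue (perturbedDirac m q V hV) z) := by
  by_cases h : HasFloquetMultiplier m q a z
  · have hκ := h.quasimomentum_im_pos ha
    refine ⟨?_, fun hp1 hlt => ?_⟩
    · rintro rfl hlt
      rw [ENNReal.ofReal_one, memLp_one_iff_integrable] at hVp
      exact h.not_isEigenvalue ha hper hV (integrable_exp_neg_mul_abs_sub_mul_norm hκ hV)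
        (integral_exp_neg_mul_abs_sub_mul_norm_le_one hκ hV hVp) hlt
    · refine h.not_isEigenvalue ha hper hV (integrable_exp_neg_mul_abs_sub_mul_norm hκ hV)
        (integral_exp_neg_mul_abs_sub_mul_norm_le hκ hp1 hVp) ?_
      have hp0 : 0 < p := one_pos.trans hp1
      have hp2 : 0 < p - 1 := sub_pos.2 hp1
      -- The factor in the hypothesis is the reciprocal of the Hölder constant; dividing by it
      -- isolates Γ γ₊ γ₋.
      rw [mul_assoc _ ((quasimomentum m q a z).im ^ _), ← Real.mul_rpow hκ.le (by positivity),
        ← div_lt_iff₀ (by positivity), div_eq_inv_mul, ← Real.inv_rpow (by positivity)] at hlt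
      have hb : 2 * (p - 1) / ((quasimomentum m q a z).im * p) =
          ((quasimomentum m q a z).im * (p / (2 * (p - 1))))⁻¹ := by field_simp
      rwa [hb]
  -- With γ₊ = 0 both smallness conditions would put a nonnegative norm strictly below 0.
  · rw [gammaPlus_eq_zero h]
    refine ⟨fun _ hlt => ?_, fun _ hlt => ?_⟩
    · exact absurd hlt (by simpa using potentialNorm_nonneg 1 V)
    · exact absurd hlt (by simpa using potentialNorm_nonneg p V)
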